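/- **Proposition 2.4 (no-arbitrage of indifference prices).** *Market.* Let $(\Omega,\mathcal F,\mathbb G,\mathbb P)$, $\mathbb G=(\mathcal G_t)_{0\le t\le T}$, be a filtered probability space satisfying the usual conditions with $\mathcal G_T=\mathcal F$. Let $\hat S$ be an $\mathbb R^d$-valued continuous $\mathbb G$-semimartingale and $B$ a continuous, non-decreasing, $\mathbb G$-adapted process with $B_0$ bounded below by a positive constant, and assume that $S=\hat S/B$ is a $\mathbb G$-local martingale under some probability measure $\mathbb Q\sim\mathbb P$. Let $\mathbb F^{\rm buy},\mathbb F^{\rm sell}$ be two (possibly different) filtrations satisfying the usual conditions with $\mathbb F^{S,B}\subseteq\mathbb F^{\rm buy},\mathbb F^{\rm sell}\subseteq\mathbb G$, where $\mathbb F^{S,B}$ is the augmented natural filtration of $(\hat S,B)$. Let $\hat\xi$ be a bounded, $\mathbb F^{S,B}$-adapted process with a.s. continuous paths, $\xi=\hat\xi/B$, and let the set of exercise times $\mathcal I$ be $[0,T]$ or a closed countable subset of $[0,T]$. For $t\in[0,T]$, $\mathcal T^{\rm buy/sell}_{t,T}$ denotes the set of $\mathbb F^{\rm buy/sell}$-stopping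 times with values in $\mathcal I\cap[t,T]$. *Strategies.* $\mathcal H_{\rm buy/sell}$ is the set of $\mathbb R^d$-valued $\mathbb F^{\rm buy/sell}$-predictable processes. Stochastic integrals are taken in the agent's filtration. A strategy $h$ is called *admissible on* $(t,T]$ if $\int_t^{\cdot}h_s\,dS_s$ exists, is bounded from below on $[t,T]$ by a constant, and $\int_t^Th_s\,dS_s\in L^\infty$. The set of claims $\int_t^T h_s\,dS_s$, with $h\in\mathcal H_{\rm buy/sell}$ admissible on $(t,T]$, is denoted $\mathcal C^{\rm buy/sell}_{t,T}$. $\mathcal H'_{\rm sell}$ is the set of maps $H:\mathcal I\times[0,T]\times\Omega\to\mathbb R^d$ such that $H(u,\cdot,\cdot)\in\mathcal H_{\rm sell}$ for every $u\in\mathcal I$; $H(u_1,s,\cdot)=H(u_2,s,\cdot)$ for $s\le u_1\wedge u_2$; if $\mathcal I=[0,T]$, $H$ is right-continuous in its first variable; and (at the time $t$ considered) $h^\tau_s(\omega):=H(\tau(\omega),s,\omega)$ is admissible on $(t,T]$ for every $\tau\in\mathcal T^{\rm sell}_{t,T}$. *Risk measures.* A time-consistent fully dynamic convex risk measure on a filtration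 $\mathbb F$ is a family of maps $\rho_{s,t}:L^\infty(\mathcal F_t)\to L^\infty(\mathcal F_s)$, $0\le s\le t\le T$, such that, $\mathbb P$-a.s., for all $s\le t\le u$: $\rho_{s,t}(\zeta_1)\le\rho_{s,t}(\zeta_2)$ if $\zeta_1\ge\zeta_2$; $\rho_{s,t}(\zeta+m)=\rho_{s,t}(\zeta)-m$ for $m\in L^\infty(\mathcal F_s)$; $\rho_{s,t}(\lambda\zeta_1+(1-\lambda)\zeta_2)\le\lambda\rho_{s,t}(\zeta_1)+(1-\lambda)\rho_{s,t}(\zeta_2)$ for $\lambda\in[0,1]$; and $\rho_{t,u}(\zeta_1)=\rho_{t,u}(\zeta_2)$ implies $\rho_{s,u}(\zeta_1)=\rho_{s,u}(\zeta_2)$. No normalization is required. The residual risks are $$\hat\rho_{t,T}(\zeta)=\operatorname*{ess\,inf}_{C\in\mathcal C^{\rm buy}_{t,T}}\rho_{t,T}(\zeta+C),\qquad \check\rho_{t,T}(\zeta)=\operatorname*{ess\,inf}_{C\in\mathcal C^{\rm sell}_{t,T}}\rho_{t,T}(\zeta+C).$$ Fix $t\in[0,T]$. (i) *Seller.* Let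 $\rho$ be a time-consistent fully dynamic convex risk measure on a filtration $\mathbb F$ with $\mathbb F^{\rm sell}\subseteq\mathbb F\subseteq\mathbb G$ (for instance $\mathbb F=\mathbb F^{\rm sell}$), with $\check\rho_{t,T}(0)>-\infty$ a.s. Then the seller's price $$P^{\rm sell}_t=\operatorname*{ess\,inf}_{H\in\mathcal H'_{\rm sell}}\ \operatorname*{ess\,sup}_{\tau\in\mathcal T^{\rm sell}_{t,T}}\rho_{t,T}\Bigl(\int_t^Th^\tau_s\,dS_s-\xi_\tau\Bigr)-\check\rho_{t,T}(0)\tag{S}$$ admits no seller's arbitrage: there are no $\hat H\in\mathcal H'_{\rm sell}$ and $x\in L^\infty(\mathcal F_t)$ with $\mathbb P(x<P^{\rm sell}_t)>0$ (in particular, none with $x<P^{\rm sell}_t$ a.s.) such that $x+\int_t^T\hat h^\tau_s\,dS_s-\xi_\tau\ge0$ a.s. for all $\tau\in\mathcal T^{\rm sell}_{t,T}$. (ii) *Buyer.* Let $\rho$ be a time-consistent fully dynamic convex risk measure on a filtration $\mathbb F$ with $\mathbb F^{\rm buy}\subseteq\mathbb F\subseteq\mathbb G$, with $\hat\rho_{t,T}(0)>-\infty$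 a.s. Then the buyer's price $$P^{\rm buy}_t=\hat\rho_{t,T}(0)-\operatorname*{ess\,inf}_{\tau\in\mathcal T^{\rm buy}_{t,T}}\hat\rho_{t,T}(\xi_\tau)\tag{B}$$ admits no buyer's arbitrage: there are no $\hat h\in\mathcal H_{\rm buy}$ admissible on $(t,T]$, $\tau\in\mathcal T^{\rm buy}_{t,T}$ and $x\in L^\infty(\mathcal F_t)$ with $\mathbb P(x>P^{\rm buy}_t)>0$ (in particular, none with $x>P^{\rm buy}_t$ a.s.) such that $-x+\int_t^T\hat h_s\,dS_s+\xi_\tau\ge0$ a.s. -/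

import Mathlib

open MeasureTheory ProbabilityTheory Filter Topology
open scoped NNReal ENNReal

noncomputable section

/-! ### Essential infima and suprema of arbitrary families of random variables -/

section EssentialBounds

variable {Ω ι : Type*} [MeasurableSpace Ω]

/-- `g` is a version of the essential infimum of the family `X`: it is the `P`-a.s. largest random
variable that is a.s. below every member of the family. -/
structure IsEssInf (P : Measure Ω) (X : ι → Ω → EReal) (g : Ω → EReal) : Prop where
  measurable : Measurable g
  le : ∀ i, g ≤ᵐ[P] X i
  greatest : ∀ g' : Ω → EReal, Measurable g' → (∀ i, g' ≤ᵐ[P] X i) → g' ≤ᵐ[P] g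

/-- The essential infimum of any family of random variables exists. -/
theorem exists_isEssInf (P : Measure Ω) [IsProbabilityMeasure P] (X : ι → Ω → EReal) :
    ∃ g, IsEssInf P X g := by
  let φ : EReal ≃o Set.Iic (1 : ℝ≥0∞) :=
    ENNReal.logOrderIso.symm.trans ENNReal.orderIsoIicOneBirational
  have hφm : Measurable fun x : EReal => (φ x : ℝ≥0∞) :=
    Monotone.measurable fun x y h => φ.monotone h
  let 𝒞 : Set (Ω → EReal) := {g | Measurable g ∧ ∀ i, g ≤ᵐ[P] X i}
  let J : (Ω → EReal) → ℝ≥0∞ := fun g => ∫⁻ ω, (φ (g ω) : ℝ≥0∞) ∂P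
  have hJ1 : ∀ g, J g ≤ 1 := fun g => by
    calc J g ≤ ∫⁻ _, 1 ∂P := lintegral_mono fun ω => (φ (g ω)).2
      _ = 1 := by simp
  have hbot : (fun _ => ⊥ : Ω → EReal) ∈ 𝒞 :=
    ⟨measurable_const, fun i => Eventually.of_forall fun _ => bot_le⟩
  have hne : (J '' 𝒞).Nonempty := ⟨_, Set.mem_image_of_mem J hbot⟩
  obtain ⟨u, -, hu, hmem⟩ := exists_seq_tendsto_sSup hne (OrderTop.bddAbove _)
  choose gs hgs hgsJ using hmem
  let g : Ω → EReal := fun ω => ⨆ n, gs n ω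
  have hg : g ∈ 𝒞 := by
    refine ⟨Measurable.iSup fun n => (hgs n).1, fun i => ?_⟩
    filter_upwards [ae_all_iff.2 fun n => (hgs n).2 i] with ω hω using iSup_le hω
  have hJg : sSup (J '' 𝒞) ≤ J g := by
    refine le_of_tendsto' hu fun n => ?_
    rw [← hgsJ n]
    exact lintegral_mono fun ω => φ.monotone (le_iSup (fun n => gs n ω) n)
  refine ⟨g, hg.1, hg.2, fun g' hg'm hg' => ?_⟩
  have hmax : (fun ω => max (g ω) (g' ω)) ∈ 𝒞 := by
    refine ⟨hg.1.max hg'm, fun i => ?_⟩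
    filter_upwards [hg.2 i, hg' i] with ω h1 h2 using max_le h1 h2
  have hle : J (fun ω => max (g ω) (g' ω)) ≤ J g :=
    (le_sSup (Set.mem_image_of_mem J hmax)).trans hJg
  have hae := ae_eq_of_ae_le_of_lintegral_le
    (f := fun ω => (φ (g ω) : ℝ≥0∞)) (g := fun ω => (φ (max (g ω) (g' ω)) : ℝ≥0∞))
    (Eventually.of_forall fun ω => φ.monotone (le_max_left _ _))
    ((hJ1 g).trans_lt ENNReal.one_lt_top).ne (hφm.comp (hg.1.max hg'm)).aemeasurable hle
  filter_upwards [hae] with ω hω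
  have h := φ.injective (Subtype.ext hω)
  rw [h]
  exact le_max_right _ _

/-- The essential infimum of a family of random variables (unique up to a.s. equality). -/
def essInfFam (P : Measure Ω) [IsProbabilityMeasure P] (X : ι → Ω → EReal) : Ω → EReal :=
  (exists_isEssInf P X).choose

theorem essInfFam_spec (P : Measure Ω) [IsProbabilityMeasure P] (X : ι → Ω → EReal) :
    IsEssInf P X (essInfFam P X) :=
  (exists_isEssInf P X).choose_spec

/-- The essential supremum of a family of random variables, `ess sup X = - ess inf (-X)`. -/
def essSupFam (P : Measure Ω) [IsProbabilityMeasure P] (X : ι → Ω → EReal) : Ω → EReal :=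
  fun ω => -essInfFam P (fun i ω => -X i ω) ω

end EssentialBounds

/-! ### Time, filtrations, stopping times -/

/-- The time interval `[0, T]`; its least element `⊥` is `0` and its greatest element `⊤` is `T`. -/
abbrev Time (T : ℝ≥0) : Type := Set.Iic T

/-- Euclidean space `ℝ^d`. -/
abbrev Euc (d : ℕ) : Type := EuclideanSpace ℝ (Fin d)

section Processes

variable {Ω : Type*} [mΩ : MeasurableSpace Ω] {T : ℝ≥0}

/-- The usual conditions: right-continuity, and every `P`-null set belongs to `𝔽 0`. -/
structure UsualConditions (𝔽 : Filtration (Time T) mΩ) (P : Measure Ω) : Prop where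
  rightCont : 𝔽.IsRightContinuous
  complete : ∀ N : Set Ω, P N = 0 → MeasurableSet[𝔽 ⊥] N

/-- `[0, T]`-valued stopping times. -/
def IsStopping (𝔽 : Filtration (Time T) mΩ) (τ : Ω → Time T) : Prop :=
  IsStoppingTime 𝔽 fun ω => (τ ω : WithTop (Time T))

/-- `X` belongs to `L^∞(Ω, m, P)`. -/
def MemLInf {Ω : Type*} (m : MeasurableSpace Ω) {mΩ : MeasurableSpace Ω} (P : Measure Ω)
    (X : Ω → ℝ) : Prop :=
  AEStronglyMeasurable[m] X P ∧ MemLp X ⊤ P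

section Integral

variable {E : Type*} [NormedAddCommGroup E] [InnerProductSpace ℝ E]

/-- Simple predictable processes `∑ i, ξ_i 1_{(σ_i, τ_i]}` with stopping times `σ_i ≤ τ_i` and bounded
`𝔽_{σ_i}`-measurable coefficients `ξ_i`. -/
structure SimplePredictable (𝔽 : Filtration (Time T) mΩ) (E : Type*) [NormedAddCommGroup E] where
  n : ℕ
  σ : Fin n → Ω → Time T
  τ : Fin n → Ω → Time T
  ξ : Fin n → Ω → E
  isStopping_σ : ∀ i, IsStopping 𝔽 (σ i)
  isStopping_τ : ∀ i, IsStopping 𝔽 (τ i)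
  σ_le_τ : ∀ i ω, σ i ω ≤ τ i ω
  measurable_ξ : ∀ i, StronglyMeasurable[(isStopping_σ i).measurableSpace] (ξ i)
  bounded_ξ : ∃ K : ℝ, ∀ i ω, ‖ξ i ω‖ ≤ K

/-- The process `∑ i, ξ_i 1_{(σ_i, τ_i]}`. -/
def SimplePredictable.process {𝔽 : Filtration (Time T) mΩ} (h : SimplePredictable 𝔽 E) :
    Time T → Ω → E :=
  fun s ω => ∑ i, if h.σ i ω < s ∧ s ≤ h.τ i ω then h.ξ i ω else 0

/-- The elementary integral `∫_0^s h dX = ∑ i, ξ_i · (X_{s ∧ τ_i} - X_{s ∧ σ_i})`. -/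
def SimplePredictable.integral {𝔽 : Filtration (Time T) mΩ} (h : SimplePredictable 𝔽 E)
    (X : Time T → Ω → E) : Time T → Ω → ℝ :=
  fun s ω => ∑ i, inner ℝ (h.ξ i ω) (X (min s (h.τ i ω)) ω - X (min s (h.σ i ω)) ω)

/-- Convergence `V_n → V` in the semimartingale (Émery) topology on `[0, T]`:
`sup_{|K| ≤ 1} P(∃ s, |(V_n - V)_0| + |∫_0^s K d(V_n - V)| ≥ ε) → 0` for all `ε > 0`, the
supremum being over the simple predictable `K` bounded by `1`. -/
def EmeryTendsto (𝔽 : Filtration (Time T) mΩ) (P : Measure Ω)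
    (Vn : ℕ → Time T → Ω → ℝ) (V : Time T → Ω → ℝ) : Prop :=
  ∀ ε : ℝ, 0 < ε → Tendsto
    (fun n => ⨆ K : {K : SimplePredictable 𝔽 ℝ // ∀ s ω, |K.process s ω| ≤ 1},
      P {ω | ∃ s, ε ≤ |Vn n ⊥ ω - V ⊥ ω| + |K.1.integral (fun r ω => Vn n r ω - V r ω) s ω|})
    atTop (𝓝 0)

/-- `IsStochIntegral 𝔽 P X h V` says that `h` is integrable with respect to the continuous
`𝔽`-semimartingale `X` and that `V = ∫_0^· h dX`.

The (vector) stochastic integral is obtained from the elementary one by taking limits: whenever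
`h_n → h` pointwise on `(0, T] × Ω` and the integrals of the `h_n` converge to `V` in the
semimartingale topology, `V` is the integral of `h`. This relation is the graph of the usual vector
stochastic integral. Indeed, by dominated convergence and a monotone class argument it contains all
bounded predictable integrands, hence, through the truncations `h 1_{|h| ≤ n}`, all `h ∈ L(X)`; and
`L(X)` is stable under such limits since the space of integrals is closed in the semimartingale
topology. The integral is determined up to indistinguishability. -/
inductive IsStochIntegral (𝔽 : Filtration (Time T) mΩ) (P : Measure Ω) (X : Time T → Ω → E) :
    (Time T → Ω → E) → (Time T → Ω → ℝ) → Prop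
  | simple (h : SimplePredictable 𝔽 E) : IsStochIntegral 𝔽 P X h.process (h.integral X)
  | limit (hn : ℕ → Time T → Ω → E) (Vn : ℕ → Time T → Ω → ℝ) (h : Time T → Ω → E)
      (V : Time T → Ω → ℝ) (hV : ∀ n, IsStochIntegral 𝔽 P X (hn n) (Vn n))
      (hlim : ∀ s ω, ⊥ < s → Tendsto (fun n => hn n s ω) atTop (𝓝 (h s ω)))
      (Vlim : EmeryTendsto 𝔽 P Vn V) : IsStochIntegral 𝔽 P X h V

/-- `V` is the wealth process `∫_s^· h dX` of the strategy `h` started from zero wealth at time `s`;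
it is bounded from below on `[s, t]` by a constant, and its value at time `t` is in `L^∞`. -/
structure IsWealth (𝔽 : Filtration (Time T) mΩ) (P : Measure Ω) (X : Time T → Ω → E) (s t : Time T)
    (h : Time T → Ω → E) (V : Time T → Ω → ℝ) : Prop where
  integral : IsStochIntegral 𝔽 P X (fun r ω => if s < r ∧ r ≤ t then h r ω else 0) V
  bddBelow : ∃ c : ℝ, ∀ᵐ ω ∂P, ∀ r, s ≤ r → r ≤ t → c ≤ V r ω
  bounded : MemLp (V t) ⊤ P

end Integral

section Semimartingale

variable {E : Type*} [NormedAddCommGroup E] [NormedSpace ℝ E] [CompleteSpace E]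

/-- Continuous local martingales on `[0, T]` (with localizing sequences that are eventually infinite,
i.e. eventually do not stop the process on `[0, T]`). -/
def IsContLocalMartingale (𝔽 : Filtration (Time T) mΩ) (P : Measure Ω) (M : Time T → Ω → E) : Prop :=
  StronglyAdapted 𝔽 M ∧ (∀ᵐ ω ∂P, Continuous fun s => M s ω) ∧
    Locally (fun N => Martingale N 𝔽 P) 𝔽 M P

/-- Continuous semimartingales: `X = X_0 + M + A` with a continuous local martingale `M` and a
continuous adapted process `A` of finite variation. -/
def IsContSemimartingale (𝔽 : Filtration (Time T) mΩ) (P : Measure Ω) (X : Time T → Ω → E) : Prop :=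
  StronglyAdapted 𝔽 X ∧ ∃ M A : Time T → Ω → E, IsContLocalMartingale 𝔽 P M ∧
    StronglyAdapted 𝔽 A ∧
    (∀ᵐ ω ∂P, (Continuous fun s => A s ω) ∧ BoundedVariationOn (fun s => A s ω) Set.univ) ∧
    ∀ᵐ ω ∂P, ∀ s, X s ω = X ⊥ ω + M s ω + A s ω

end Semimartingale

/-! ### The market -/

/-- The augmented natural filtration of a pair of processes: the right-continuous version of
`σ(Y_u, B_u : u ≤ t) ∨ {null sets}` (at the terminal time no right limit is taken). -/
abbrev augmentedInfo {d : ℕ} (P : Measure Ω) (Y : Time T → Ω → Euc d) (B : Time T → Ω → ℝ)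
    (t : Time T) : MeasurableSpace Ω :=
  ⨅ s : Time T, ⨅ _ : t < s ∨ s = ⊤,
    ((⨆ u : Time T, ⨆ _ : u ≤ s,
        (MeasurableSpace.comap (Y u) (borel (Euc d)) ⊔ MeasurableSpace.comap (B u) (borel ℝ))) ⊔
      MeasurableSpace.generateFrom {N : Set Ω | P N = 0})

/-- The discounted price process `S = Ŝ / B`. -/
def discounted {E : Type*} [AddCommGroup E] [Module ℝ E] (B : Time T → Ω → ℝ)
    (Y : Time T → Ω → E) : Time T → Ω → E :=
  fun s ω => (B s ω)⁻¹ • Y s ω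

/-- The financial market, with the information of buyer and seller. -/
structure Market (Ω : Type*) [mΩ : MeasurableSpace Ω] (P : Measure Ω) (T : ℝ≥0) (d : ℕ) where
  /-- The full information `𝔾`. -/
  𝔾 : Filtration (Time T) mΩ
  /-- The risky assets `Ŝ`. -/
  asset : Time T → Ω → Euc d
  /-- The riskless asset `B`. -/
  bank : Time T → Ω → ℝ
  /-- The buyer's information. -/
  buy : Filtration (Time T) mΩ
  /-- The seller's information. -/
  sell : Filtration (Time T) mΩ
  usual_𝔾 : UsualConditions 𝔾 P
  𝔾_top : 𝔾 ⊤ = mΩ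
  semimartingale : IsContSemimartingale 𝔾 P asset
  bank_adapted : StronglyAdapted 𝔾 bank
  bank_continuous : ∀ᵐ ω ∂P, Continuous fun s => bank s ω
  bank_monotone : ∀ᵐ ω ∂P, Monotone fun s => bank s ω
  bank_pos : ∃ b : ℝ, 0 < b ∧ ∀ᵐ ω ∂P, b ≤ bank ⊥ ω
  /-- There is an equivalent local martingale measure for the discounted assets. -/
  exists_martingaleMeasure : ∃ Q : Measure Ω, IsProbabilityMeasure Q ∧ Q ≪ P ∧ P ≪ Q ∧
    IsContLocalMartingale 𝔾 Q (discounted bank asset)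
  usual_buy : UsualConditions buy P
  usual_sell : UsualConditions sell P
  info_le_buy : ∀ t, augmentedInfo P asset bank t ≤ buy t
  info_le_sell : ∀ t, augmentedInfo P asset bank t ≤ sell t
  buy_le : buy ≤ 𝔾
  sell_le : sell ≤ 𝔾

/-- The discounted risky assets `S`. -/
def Market.S {P : Measure Ω} {d : ℕ} (𝓜 : Market Ω P T d) : Time T → Ω → Euc d :=
  discounted 𝓜.bank 𝓜.asset

/-- The undiscounted American claim `Y`: a bounded process with a.s. continuous paths, adapted to the
augmented natural filtration of the assets. -/
structure Market.IsClaim {P : Measure Ω} {d : ℕ} (𝓜 : Market Ω P T d) (Y : Time T → Ω → ℝ) :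
    Prop where
  adapted : ∀ t, StronglyMeasurable[augmentedInfo P 𝓜.asset 𝓜.bank t] (Y t)
  continuous : ∀ᵐ ω ∂P, Continuous fun s => Y s ω
  bounded : ∃ K : ℝ, ∀ᵐ ω ∂P, ∀ s, |Y s ω| ≤ K

/-- Possible sets of exercise times: all of `[0, T]` (American) or a closed countable subset
(Bermudan). -/
def IsExerciseSet (I : Set (Time T)) : Prop :=
  I = Set.univ ∨ (IsClosed I ∧ I.Countable)

/-- Exercise strategies for the information `𝔽`: `𝔽`-stopping times with values in `I` that are
larger than or equal to `t`. -/
def exerciseTimes (𝔽 : Filtration (Time T) mΩ) (I : Set (Time T)) (t : Time T) :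
    Set (Ω → Time T) :=
  {τ | IsStopping 𝔽 τ ∧ ∀ ω, τ ω ∈ I ∧ t ≤ τ ω}

/-- The payoff `ξ_τ`. -/
def payoff (ξ : Time T → Ω → ℝ) (τ : Ω → Time T) : Ω → ℝ :=
  fun ω => ξ (τ ω) ω

/-! ### Fully dynamic risk measures -/

/-- Time-consistent fully dynamic convex risk measures `ρ_{s,t} : L^∞(𝔽_t) → L^∞(𝔽_s)`, `s ≤ t`.
Random variables are represented by functions; `mono` shows that `ρ_{s,t}` respects a.s. equality. -/
structure RiskMeasure (𝔽 : Filtration (Time T) mΩ) (P : Measure Ω) where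
  toFun : Time T → Time T → (Ω → ℝ) → Ω → ℝ
  mapsTo : ∀ s t, s ≤ t → ∀ X, MemLInf (𝔽 t) P X → MemLInf (𝔽 s) P (toFun s t X)
  mono : ∀ s t, s ≤ t → ∀ X Y, MemLInf (𝔽 t) P X → MemLInf (𝔽 t) P Y → Y ≤ᵐ[P] X →
    toFun s t X ≤ᵐ[P] toFun s t Y
  cash : ∀ s t, s ≤ t → ∀ X m, MemLInf (𝔽 t) P X → MemLInf (𝔽 s) P m →
    toFun s t (X + m) =ᵐ[P] toFun s t X - m
  convex : ∀ s t, s ≤ t → ∀ X Y, MemLInf (𝔽 t) P X → MemLInf (𝔽 t) P Y →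
    ∀ a : ℝ, 0 ≤ a → a ≤ 1 →
      toFun s t (a • X + (1 - a) • Y) ≤ᵐ[P] a • toFun s t X + (1 - a) • toFun s t Y
  consistent : ∀ s t u, s ≤ t → t ≤ u → ∀ X Y, MemLInf (𝔽 u) P X → MemLInf (𝔽 u) P Y →
    toFun t u X =ᵐ[P] toFun t u Y → toFun s u X =ᵐ[P] toFun s u Y

/-- The bounded claims that can be hedged at no cost between `s` and `t` by trading `X` with
`𝔽`-predictable strategies whose wealth is bounded from below. -/
def hedgeable {d : ℕ} (𝔽 : Filtration (Time T) mΩ) (P : Measure Ω) (X : Time T → Ω → Euc d)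
    (s t : Time T) : Set (Ω → ℝ) :=
  {C | ∃ h V, IsStronglyPredictable 𝔽 h ∧ IsWealth 𝔽 P X s t h V ∧ C = V t}

/-- The residual risk `ess inf_C ρ_{s,t}(ζ + C)` over the claims `C` that an agent with information
`𝔽` can hedge at no cost between `s` and `t`. -/
def residualRisk {d : ℕ} (𝔽 : Filtration (Time T) mΩ) {𝕂 : Filtration (Time T) mΩ} (P : Measure Ω)
    [IsProbabilityMeasure P] (X : Time T → Ω → Euc d) (ρ : RiskMeasure 𝕂 P) (s t : Time T)
    (ζ : Ω → ℝ) : Ω → EReal :=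
  essInfFam P fun (C : hedgeable 𝔽 P X s t) ω => ((ρ.toFun s t (ζ + C) ω : ℝ) : EReal)

/-! ### Prices and arbitrage -/

/-- The seller's strategies `H(u, s, ω)`, where `u` is the realized exercise time: predictable for
each `u`, not anticipating the exercise, and right-continuous in `u` if all exercise times are
possible. -/
structure IsExerciseDependent {d : ℕ} (𝔽 : Filtration (Time T) mΩ) (I : Set (Time T))
    (H : Time T → Time T → Ω → Euc d) : Prop where
  predictable : ∀ u ∈ I, IsStronglyPredictable 𝔽 (H u)
  nonanticipative : ∀ u ∈ I, ∀ v ∈ I, ∀ s ω, s ≤ min u v → H u s ω = H v s ω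
  rightCont : I = Set.univ → ∀ u s ω, Tendsto (fun v => H v s ω) (𝓝[>] u) (𝓝 (H u s ω))

/-- A seller's hedge from time `t` on: an exercise-dependent strategy `H` such that, for every
stopping time `τ`, the wealth process `∫_t^· h^τ dX` of `h^τ_s(ω) = H(τ(ω), s, ω)` is well-defined,
bounded from below, and bounded at time `T`. The wealth processes, determined by `H` up to
indistinguishability, are recorded in order to fix a version. -/
structure SellerHedge {d : ℕ} (𝔽 : Filtration (Time T) mΩ) (P : Measure Ω) (I : Set (Time T))
    (X : Time T → Ω → Euc d) (t : Time T) where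
  H : Time T → Time T → Ω → Euc d
  wealth : (Ω → Time T) → Time T → Ω → ℝ
  exerciseDependent : IsExerciseDependent 𝔽 I H
  isWealth : ∀ τ ∈ exerciseTimes 𝔽 I t,
    IsWealth 𝔽 P X t ⊤ (fun s ω => H (τ ω) s ω) (wealth τ)

/-- The seller's indifference price
`ess inf_H ess sup_τ ρ_{t,T}(∫_t^T h^τ dX - ξ_τ) - ess inf_C ρ_{t,T}(C)`. -/
def sellerPrice {d : ℕ} (𝔽 : Filtration (Time T) mΩ) {𝕂 : Filtration (Time T) mΩ} (P : Measure Ω)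
    [IsProbabilityMeasure P] (I : Set (Time T)) (X : Time T → Ω → Euc d) (ξ : Time T → Ω → ℝ)
    (ρ : RiskMeasure 𝕂 P) (t : Time T) : Ω → EReal :=
  fun ω =>
    essInfFam P (fun G : SellerHedge 𝔽 P I X t =>
      essSupFam P fun (τ : exerciseTimes 𝔽 I t) ω =>
        ((ρ.toFun t ⊤ (G.wealth τ ⊤ - payoff ξ τ) ω : ℝ) : EReal)) ω
    - residualRisk 𝔽 P X ρ t ⊤ 0 ω

/-- The buyer's indifference price
`ess inf_C ρ_{t,T}(C) - ess inf_τ ess inf_C ρ_{t,T}(ξ_τ + C)`. -/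
def buyerPrice {d : ℕ} (𝔽 : Filtration (Time T) mΩ) {𝕂 : Filtration (Time T) mΩ} (P : Measure Ω)
    [IsProbabilityMeasure P] (I : Set (Time T)) (X : Time T → Ω → Euc d) (ξ : Time T → Ω → ℝ)
    (ρ : RiskMeasure 𝕂 P) (t : Time T) : Ω → EReal :=
  fun ω =>
    residualRisk 𝔽 P X ρ t ⊤ 0 ω
    - essInfFam P (fun τ : exerciseTimes 𝔽 I t => residualRisk 𝔽 P X ρ t ⊤ (payoff ξ τ)) ω

/-- The price `p` at time `t` provides a seller's arbitrage opportunity: from an initial amount `x`,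
known at time `t` (i.e. `𝕂_t`-measurable), with `x < p` on an event of positive probability (in
particular if `x < p` a.s.), the seller can cover the claim for every exercise strategy. -/
def SellerArbitrage {d : ℕ} (𝔽 : Filtration (Time T) mΩ) (P : Measure Ω) (I : Set (Time T))
    (X : Time T → Ω → Euc d) (ξ : Time T → Ω → ℝ) (t : Time T)
    (𝕂 : Filtration (Time T) mΩ) (p : Ω → EReal) : Prop :=
  ∃ (G : SellerHedge 𝔽 P I X t) (x : Ω → ℝ), MemLInf (𝕂 t) P x ∧ 0 < P {ω | (x ω : EReal) < p ω} ∧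
    ∀ τ ∈ exerciseTimes 𝔽 I t, ∀ᵐ ω ∂P, 0 ≤ x ω + G.wealth τ ⊤ ω - payoff ξ τ ω

/-- The price `p` at time `t` provides a buyer's arbitrage opportunity: with some hedge and some
exercise strategy the buyer can cover an initial debt of `x`, known at time `t` (i.e.
`𝕂_t`-measurable), with `x > p` on an event of positive probability (in particular if `x > p` a.s.). -/
def BuyerArbitrage {d : ℕ} (𝔽 : Filtration (Time T) mΩ) (P : Measure Ω) (I : Set (Time T))
    (X : Time T → Ω → Euc d) (ξ : Time T → Ω → ℝ) (t : Time T)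
    (𝕂 : Filtration (Time T) mΩ) (p : Ω → EReal) : Prop :=
  ∃ (h : Time T → Ω → Euc d) (V : Time T → Ω → ℝ), IsStronglyPredictable 𝔽 h ∧
    IsWealth 𝔽 P X t ⊤ h V ∧ ∃ τ ∈ exerciseTimes 𝔽 I t, ∃ x : Ω → ℝ, MemLInf (𝕂 t) P x ∧
      0 < P {ω | p ω < (x ω : EReal)} ∧ ∀ᵐ ω ∂P, 0 ≤ -x ω + V ⊤ ω + payoff ξ τ ω

end Processes

end

/-! ### Measurability in a σ-algebra that contains all null sets -/

section Measurability

variable {Ω : Type*} {m : MeasurableSpace Ω} [mΩ : MeasurableSpace Ω] {P : Measure Ω}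

/-! A hedge that covers the claim can be run on top of any other zero-cost strategy, and the
indifference price already optimizes over such combinations.

Seller: if `G` covers the claim from `x`, then for every hedgeable `C` and every `τ` the position
wealth + `C` - payoff dominates `C - x`. Monotonicity and cash invariance bound its risk by `ρ(C) +
x`, uniformly in `τ`. Since `G` plus the strategy behind `C` is again a seller's hedge, the inf-sup
in the price is at most `ρ(C) + x`; the infimum over `C` gives price `≤ x` a.s.

Buyer: if `W_T + ξ_τ ≥ x`, then `ρ(ξ_τ + C + W_T) ≤ ρ(C) - x`. As `C + W_T` is hedgeable, the
residual risk of `ξ_τ` is at most that of `0` minus `x`, so `x ≤` price a.s.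

Two facts carry this. Wealth processes add (`IsStochIntegral.add`, `IsWealth.add`), and terminal
wealth and payoffs lie in the domain of `ρ` (`Market.memLInf_wealth`,
`Market.IsClaim.memLInf_payoff`). The risk estimate is `RiskMeasure.le_sub_of_add_le`. -/

theorem Measurable.congr_of_null_measurable {β : Type*} [MeasurableSpace β]
    (hm : ∀ N : Set Ω, P N = 0 → MeasurableSet[m] N) {f g : Ω → β} (hg : Measurable[m] g)
    (h : f =ᵐ[P] g) : Measurable[m] f := by
  intro A hA
  have hN : MeasurableSet[m] {ω | ¬ f ω = g ω} := hm _ h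
  have hN' : MeasurableSet[m] (f ⁻¹' A ∩ {ω | ¬ f ω = g ω}) :=
    hm _ (measure_mono_null Set.inter_subset_right h)
  -- The second piece is a null set, hence measurable whatever `f` does there.
  have : f ⁻¹' A = (g ⁻¹' A \ {ω | ¬ f ω = g ω}) ∪ (f ⁻¹' A ∩ {ω | ¬ f ω = g ω}) := by
    ext ω
    by_cases hω : f ω = g ω <;> simp [hω]
  rw [this]
  exact ((hg hA).diff hN).union hN'

/-- The exceptional set is itself measurable, so setting everything to zero on it turns a.s.
convergence into pointwise convergence. -/
theorem measurable_of_tendsto_ae_of_null_measurable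
    (hm : ∀ N : Set Ω, P N = 0 → MeasurableSet[m] N) {f : ℕ → Ω → ℝ} {g : Ω → ℝ}
    (hf : ∀ n, Measurable[m] (f n))
    (h : ∀ᵐ ω ∂P, Tendsto (fun n => f n ω) atTop (𝓝 (g ω))) : Measurable[m] g := by
  let N : Set Ω := {ω | ¬ Tendsto (fun n => f n ω) atTop (𝓝 (g ω))}
  have hN : MeasurableSet[m] N := hm N h
  have hlim : Measurable[m] (Nᶜ.indicator g) := by
    refine @measurable_of_tendsto_metrizable _ _ m _ _ _ _ (fun n => Nᶜ.indicator (f n)) _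
      (fun n => (hf n).indicator hN.compl) (tendsto_pi_nhds.2 fun ω => ?_)
    by_cases hω : ω ∈ N
    · simp [hω]
    · simpa [hω] using not_not.1 hω
  refine hlim.congr_of_null_measurable hm ?_
  filter_upwards [h] with ω hω
  have : ω ∈ Nᶜ := fun h' => h' hω
  simp [this]

/-- A process with a.s. continuous paths, evaluated at a random time. -/
theorem measurable_eval_of_ae_continuous {T : ℝ≥0} {E : Type*} [NormedAddCommGroup E]
    [SecondCountableTopology E] [MeasurableSpace E] [BorelSpace E]
    (hm : ∀ N : Set Ω, P N = 0 → MeasurableSet[m] N) {X : Time T → Ω → E}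
    (hX : ∀ s, Measurable[m] (X s)) (hc : ∀ᵐ ω ∂P, Continuous fun s => X s ω)
    {τ : Ω → Time T} (hτ : Measurable[m] τ) : Measurable[m] fun ω => X (τ ω) ω := by
  let N : Set Ω := {ω | ¬ Continuous fun s => X s ω}
  have hN : MeasurableSet[m] N := hm N hc
  let Z : Time T → Ω → E := fun s => Nᶜ.indicator (X s)
  have hZm : ∀ s, StronglyMeasurable[m] (Z s) := fun s =>
    ((hX s).indicator hN.compl).stronglyMeasurable
  have hZc : ∀ ω, Continuous fun s => Z s ω := fun ω => by
    by_cases hω : ω ∈ N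
    · simpa [Z, hω] using continuous_const
    · simpa [Z, hω] using not_not.1 hω
  have hjoint := @stronglyMeasurable_uncurry_of_continuous_of_stronglyMeasurable
    Ω E (Time T) _ _ _ _ _ _ _ m Z hZc hZm
  have hpair : @Measurable _ _ m (@Prod.instMeasurableSpace _ _ _ m) fun ω => (τ ω, ω) :=
    hτ.prodMk (@measurable_id _ m)
  have hZτ : Measurable[m] fun ω => Z (τ ω) ω :=
    @Measurable.comp _ _ _ m (@Prod.instMeasurableSpace _ _ _ m) _ _ _ hjoint.measurable hpair
  refine hZτ.congr_of_null_measurable hm ?_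
  filter_upwards [hc] with ω hω
  have : ω ∈ Nᶜ := fun h' => h' hω
  simp [Z, this]

end Measurability

/-! ### Additivity and terminal measurability of stochastic integrals -/

section Integrals

variable {Ω : Type*} [mΩ : MeasurableSpace Ω] {T : ℝ≥0} {P : Measure Ω}
  {𝔽 : Filtration (Time T) mΩ} {E : Type*} [NormedAddCommGroup E]

theorem IsStopping.measurable_top {τ : Ω → Time T} (hτ : IsStopping 𝔽 τ) :
    Measurable[𝔽 ⊤] τ :=
  @measurable_of_Iic _ _ _ _ _ (𝔽 ⊤) _ _ _ _ fun s => by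
    have := 𝔽.mono le_top _ (hτ s)
    simp only [WithTop.coe_le_coe] at this
    exact this

theorem UsualConditions.measurableSet_of_null {N : Set Ω} (h : UsualConditions 𝔽 P) (t : Time T)
    (hN : P N = 0) : MeasurableSet[𝔽 t] N :=
  𝔽.mono bot_le _ (h.complete N hN)

/-- The σ-algebra depends on the stopping time, so `Fin.append` cannot simply be rewritten inside
it; `SimplePredictable.add` transports measurability along these equalities instead. -/
theorem IsStopping.stronglyMeasurable_congr {σ σ' : Ω → Time T} {ξ ξ' : Ω → E}
    (hσ : IsStopping 𝔽 σ) (hσ' : IsStopping 𝔽 σ') (h : StronglyMeasurable[hσ.measurableSpace] ξ)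
    (e : σ' = σ) (e' : ξ' = ξ) : StronglyMeasurable[hσ'.measurableSpace] ξ' := by
  subst e e'
  exact h

/-- The sum of two simple predictable processes. -/
def SimplePredictable.add (h k : SimplePredictable 𝔽 E) : SimplePredictable 𝔽 E where
  n := h.n + k.n
  σ := Fin.append h.σ k.σ
  τ := Fin.append h.τ k.τ
  ξ := Fin.append h.ξ k.ξ
  isStopping_σ := Fin.addCases (fun i => by simpa using h.isStopping_σ i)
    (fun i => by simpa using k.isStopping_σ i)
  isStopping_τ := Fin.addCases (fun i => by simpa using h.isStopping_τ i)
    (fun i => by simpa using k.isStopping_τ i)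
  σ_le_τ := Fin.addCases (fun i => by simpa using h.σ_le_τ i)
    (fun i => by simpa using k.σ_le_τ i)
  measurable_ξ := Fin.addCases
    (fun i => (h.isStopping_σ i).stronglyMeasurable_congr _ (h.measurable_ξ i)
      (Fin.append_left ..) (Fin.append_left ..))
    (fun i => (k.isStopping_σ i).stronglyMeasurable_congr _ (k.measurable_ξ i)
      (Fin.append_right ..) (Fin.append_right ..))
  bounded_ξ := by
    obtain ⟨a, ha⟩ := h.bounded_ξ
    obtain ⟨b, hb⟩ := k.bounded_ξ
    exact ⟨max a b, Fin.addCases (fun i ω => by simpa using Or.inl (ha i ω))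
      (fun i ω => by simpa using Or.inr (hb i ω))⟩

theorem SimplePredictable.process_add (h k : SimplePredictable 𝔽 E) :
    (h.add k).process = h.process + k.process := by
  funext s ω
  refine (Fin.sum_univ_add _).trans ?_
  simp [SimplePredictable.process, SimplePredictable.add]

/-- The simple predictable process `0`. -/
def SimplePredictable.zero (𝔽 : Filtration (Time T) mΩ) (E : Type*) [NormedAddCommGroup E] :
    SimplePredictable 𝔽 E where
  n := 0
  σ := Fin.elim0
  τ := Fin.elim0
  ξ := Fin.elim0
  isStopping_σ := fun i => i.elim0
  isStopping_τ := fun i => i.elim0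
  σ_le_τ := fun i => i.elim0
  measurable_ξ := fun i => i.elim0
  bounded_ξ := ⟨0, fun i => i.elim0⟩

/-- The simple predictable process `1_{(0, T]}`. -/
def SimplePredictable.one (𝔽 : Filtration (Time T) mΩ) : SimplePredictable 𝔽 ℝ where
  n := 1
  σ := fun _ _ => ⊥
  τ := fun _ _ => ⊤
  ξ := fun _ _ => 1
  isStopping_σ := fun _ => isStoppingTime_const 𝔽 ⊥
  isStopping_τ := fun _ => isStoppingTime_const 𝔽 ⊤
  σ_le_τ := fun _ _ => bot_le
  measurable_ξ := fun _ => stronglyMeasurable_const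
  bounded_ξ := ⟨1, fun _ _ => by simp⟩

theorem SimplePredictable.abs_process_one_le (s : Time T) (ω : Ω) :
    |(SimplePredictable.one 𝔽).process s ω| ≤ 1 := by
  rw [show (SimplePredictable.one 𝔽).process s ω = if ⊥ < s ∧ s ≤ ⊤ then 1 else 0 from
    Fin.sum_univ_one _]
  split_ifs <;> simp

theorem SimplePredictable.integral_one (V : Time T → Ω → ℝ) (s : Time T) (ω : Ω) :
    (SimplePredictable.one 𝔽).integral V s ω = V s ω - V ⊥ ω := by
  refine (Fin.sum_univ_one _).trans ?_
  simp [SimplePredictable.one]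

/-- Testing with the integrand `1_{(0, T]}` yields the initial difference plus the increment of `Vn
- V`, which dominates the difference at time `s` by the triangle inequality. -/
theorem EmeryTendsto.tendsto_measure {Vn : ℕ → Time T → Ω → ℝ} {V : Time T → Ω → ℝ}
    (h : EmeryTendsto 𝔽 P Vn V) (s : Time T) :
    TendstoInMeasure P (fun n => Vn n s) atTop (V s) := by
  rw [tendstoInMeasure_iff_dist]
  intro ε hε
  refine tendsto_of_tendsto_of_tendsto_of_le_of_le tendsto_const_nhds (h ε hε)
    (fun _ => zero_le) fun n => ?_
  refine le_trans ?_ (le_iSup (fun K : {K : SimplePredictable 𝔽 ℝ //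
      ∀ s ω, |K.process s ω| ≤ 1} => P {ω | ∃ s, ε ≤ |Vn n ⊥ ω - V ⊥ ω| +
        |K.1.integral (fun r ω => Vn n r ω - V r ω) s ω|})
    ⟨SimplePredictable.one 𝔽, SimplePredictable.abs_process_one_le⟩)
  refine measure_mono fun ω hω => ⟨s, ?_⟩
  have hω' : ε ≤ |Vn n s ω - V s ω| := hω
  rw [SimplePredictable.integral_one]
  refine hω'.trans ?_
  have := abs_add_le (Vn n ⊥ ω - V ⊥ ω) ((Vn n s ω - V s ω) - (Vn n ⊥ ω - V ⊥ ω))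
  rwa [add_sub_cancel] at this

/-- Émery convergence sees only the differences `Vn - V`, from which a common summand cancels. -/
theorem EmeryTendsto.add_const {Vn : ℕ → Time T → Ω → ℝ} {V : Time T → Ω → ℝ}
    (h : EmeryTendsto 𝔽 P Vn V) (W : Time T → Ω → ℝ) :
    EmeryTendsto 𝔽 P (fun n => Vn n + W) (V + W) := by
  simpa only [EmeryTendsto, Pi.add_apply, add_sub_add_right_eq_sub] using h

variable [InnerProductSpace ℝ E]

theorem SimplePredictable.integral_add (h k : SimplePredictable 𝔽 E) (X : Time T → Ω → E) :
    (h.add k).integral X = h.integral X + k.integral X := by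
  funext s ω
  refine (Fin.sum_univ_add _).trans ?_
  simp [SimplePredictable.integral, SimplePredictable.add]

theorem IsStochIntegral.zero (X : Time T → Ω → E) :
    IsStochIntegral 𝔽 P X (fun _ _ => 0) 0 := by
  have h := IsStochIntegral.simple (P := P) (X := X) (SimplePredictable.zero 𝔽 E)
  have h1 : (SimplePredictable.zero 𝔽 E).process = fun _ _ => 0 := by
    funext s ω
    exact Fin.sum_univ_zero _
  have h2 : (SimplePredictable.zero 𝔽 E).integral X = 0 := by
    funext s ω
    exact Fin.sum_univ_zero _
  rwa [h1, h2] at h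

/-- Nested induction, taking limits in one summand at a time with the other held fixed; the base
case is the concatenation of two simple processes. -/
theorem IsStochIntegral.add {X : Time T → Ω → E} {h k : Time T → Ω → E} {V W : Time T → Ω → ℝ}
    (hV : IsStochIntegral 𝔽 P X h V) (hW : IsStochIntegral 𝔽 P X k W) :
    IsStochIntegral 𝔽 P X (h + k) (V + W) := by
  induction hV with
  | simple h =>
    induction hW with
    | simple k =>
      rw [← SimplePredictable.process_add, ← SimplePredictable.integral_add]
      exact .simple _
    | limit kn Wn k W _ klim Wlim ih =>
      -- `EmeryTendsto.add_const` puts the fixed summand on the right, whereas here it is the left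
      -- one.
      rw [add_comm _ W]
      refine .limit _ _ _ _ (fun n => add_comm (h.integral X) (Wn n) ▸ ih n) (fun s ω hs => ?_)
        (Wlim.add_const _)
      exact tendsto_const_nhds.add (klim s ω hs)
  | limit hn Vn h V _ hlim Vlim ih =>
    exact .limit _ _ _ _ ih (fun s ω hs => (hlim s ω hs).add tendsto_const_nhds)
      (Vlim.add_const _)

/-- Elementary integrals are built from values of `X` at stopping times. An Émery limit converges in
probability at time `T`, hence a.s. along a subsequence, and completeness absorbs the null set. -/
theorem IsStochIntegral.measurable_top [SecondCountableTopology E] [MeasurableSpace E]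
    [BorelSpace E] {X : Time T → Ω → E} {h : Time T → Ω → E} {V : Time T → Ω → ℝ}
    (h𝔽 : UsualConditions 𝔽 P) (hX : ∀ s, Measurable[𝔽 ⊤] (X s))
    (hc : ∀ᵐ ω ∂P, Continuous fun s => X s ω) (hV : IsStochIntegral 𝔽 P X h V) :
    Measurable[𝔽 ⊤] (V ⊤) := by
  induction hV with
  | simple h =>
    refine Finset.measurable_fun_sum _ fun i _ => ?_
    have hξ : Measurable[𝔽 ⊤] (h.ξ i) := (h.measurable_ξ i).measurable.mono
      ((h.isStopping_σ i).measurableSpace_le_of_le_const fun ω => WithTop.coe_le_coe.2 le_top)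
      le_rfl
    have hτ := measurable_eval_of_ae_continuous (fun N hN => h𝔽.measurableSet_of_null ⊤ hN) hX hc
      (h.isStopping_τ i).measurable_top
    have hσ := measurable_eval_of_ae_continuous (fun N hN => h𝔽.measurableSet_of_null ⊤ hN) hX hc
      (h.isStopping_σ i).measurable_top
    simp only [min_eq_right le_top]
    exact hξ.inner (hτ.sub hσ)
  | limit hn Vn h V _ hlim Vlim ih =>
    obtain ⟨φ, -, hφ⟩ := (Vlim.tendsto_measure ⊤).exists_seq_tendsto_ae
    exact measurable_of_tendsto_ae_of_null_measurable
      (fun N hN => h𝔽.measurableSet_of_null ⊤ hN) (fun n => ih (φ n)) hφ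

theorem IsWealth.zero (X : Time T → Ω → E) (s t : Time T) :
    IsWealth 𝔽 P X s t (fun _ _ => 0) 0 where
  integral := by simpa using IsStochIntegral.zero X
  bddBelow := ⟨0, Eventually.of_forall fun _ _ _ _ => le_rfl⟩
  bounded := MemLp.zero'

/-- Admissibility survives addition because lower bounds add and `L^∞` is a vector space. This
closure property is what lets an arbitrage be combined with any other hedge. -/
theorem IsWealth.add {X : Time T → Ω → E} {s t : Time T} {h k : Time T → Ω → E}
    {V W : Time T → Ω → ℝ} (hV : IsWealth 𝔽 P X s t h V) (hW : IsWealth 𝔽 P X s t k W) :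
    IsWealth 𝔽 P X s t (h + k) (V + W) where
  integral := by
    convert hV.integral.add hW.integral using 1
    funext r ω
    by_cases hr : s < r ∧ r ≤ t <;> simp [hr]
  bddBelow := by
    obtain ⟨a, ha⟩ := hV.bddBelow
    obtain ⟨b, hb⟩ := hW.bddBelow
    refine ⟨a + b, ?_⟩
    filter_upwards [ha, hb] with ω h1 h2 r hs ht using add_le_add (h1 r hs ht) (h2 r hs ht)
  bounded := hV.bounded.add hW.bounded

end Integrals

/-! ### Discounted prices, wealth and payoffs in the agents' filtrations -/

section MarketProperties

variable {Ω : Type*} [mΩ : MeasurableSpace Ω] {T : ℝ≥0} {P : Measure Ω} {d : ℕ}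

theorem measurable_augmentedInfo (Y : Time T → Ω → Euc d) (B : Time T → Ω → ℝ) (t : Time T) :
    Measurable[augmentedInfo P Y B t] (Y t) ∧ Measurable[augmentedInfo P Y B t] (B t) := by
  have key : MeasurableSpace.comap (Y t) (borel (Euc d)) ⊔ MeasurableSpace.comap (B t) (borel ℝ)
      ≤ augmentedInfo P Y B t := by
    refine le_iInf₂ fun s hs => le_trans ?_ le_sup_left
    -- Every index of the intersection satisfies this, including the terminal case `s = ⊤`.
    have hts : t ≤ s := by
      rcases hs with hs | rfl
      exacts [hs.le, le_top]
    exact le_iSup₂ (f := fun (u : Time T) (_ : u ≤ s) =>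
      MeasurableSpace.comap (Y u) (borel (Euc d)) ⊔ MeasurableSpace.comap (B u) (borel ℝ)) t hts
  constructor
  · refine measurable_iff_comap_le.2 (le_trans ?_ key)
    rw [BorelSpace.measurable_eq (α := Euc d)]
    exact le_sup_left
  · refine measurable_iff_comap_le.2 (le_trans ?_ key)
    rw [BorelSpace.measurable_eq (α := ℝ)]
    exact le_sup_right

namespace Market

variable (𝓜 : Market Ω P T d) {𝔽 : Filtration (Time T) mΩ}

theorem exists_le_bank :
    ∃ b : ℝ, 0 < b ∧ ∀ᵐ ω ∂P, ∀ s, b ≤ 𝓜.bank s ω := by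
  obtain ⟨b, hb, h⟩ := 𝓜.bank_pos
  refine ⟨b, hb, ?_⟩
  filter_upwards [h, 𝓜.bank_monotone] with ω h1 h2 s using h1.trans (h2 bot_le)

theorem asset_continuous : ∀ᵐ ω ∂P, Continuous fun s => 𝓜.asset s ω := by
  obtain ⟨-, M, A, hM, -, hA, hX⟩ := 𝓜.semimartingale
  filter_upwards [hM.2.1, hA, hX] with ω h1 h2 h3
  rw [funext h3]
  exact (continuous_const.add h1).add h2.1

theorem discounted_continuous {E : Type*} [NormedAddCommGroup E] [NormedSpace ℝ E]
    {Y : Time T → Ω → E} (hY : ∀ᵐ ω ∂P, Continuous fun s => Y s ω) :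
    ∀ᵐ ω ∂P, Continuous fun s => discounted 𝓜.bank Y s ω := by
  obtain ⟨b, hb, h⟩ := 𝓜.exists_le_bank
  filter_upwards [h, 𝓜.bank_continuous, hY] with ω h1 h2 h3
  exact (h2.inv₀ fun s => (hb.trans_le (h1 s)).ne').smul h3

theorem measurable_S (h𝔽 : ∀ t, augmentedInfo P 𝓜.asset 𝓜.bank t ≤ 𝔽 t) (s : Time T) :
    Measurable[𝔽 ⊤] (𝓜.S s) := by
  obtain ⟨h1, h2⟩ := measurable_augmentedInfo (P := P) 𝓜.asset 𝓜.bank s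
  have hle := (h𝔽 s).trans (𝔽.mono le_top)
  exact (h2.mono hle le_rfl).inv.smul (h1.mono hle le_rfl)

theorem memLInf_wealth (h𝔽 : ∀ t, augmentedInfo P 𝓜.asset 𝓜.bank t ≤ 𝔽 t)
    (h𝔽' : UsualConditions 𝔽 P) {s : Time T} {h : Time T → Ω → Euc d} {V : Time T → Ω → ℝ}
    (hV : IsWealth 𝔽 P 𝓜.S s ⊤ h V) : MemLInf (𝔽 ⊤) P (V ⊤) :=
  ⟨(hV.integral.measurable_top h𝔽' (𝓜.measurable_S h𝔽)
    (𝓜.discounted_continuous 𝓜.asset_continuous)).stronglyMeasurable.aestronglyMeasurable,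
    hV.bounded⟩

theorem IsClaim.memLInf_payoff [IsProbabilityMeasure P] {𝓜 : Market Ω P T d}
    {Y : Time T → Ω → ℝ} (hY : 𝓜.IsClaim Y)
    (h𝔽 : ∀ t, augmentedInfo P 𝓜.asset 𝓜.bank t ≤ 𝔽 t) (h𝔽' : UsualConditions 𝔽 P)
    {τ : Ω → Time T} (hτ : IsStopping 𝔽 τ) :
    MemLInf (𝔽 ⊤) P (payoff (discounted 𝓜.bank Y) τ) := by
  have hm : ∀ s, Measurable[𝔽 ⊤] (discounted 𝓜.bank Y s) := fun s => by
    have hle := (h𝔽 s).trans (𝔽.mono le_top)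
    exact ((measurable_augmentedInfo (P := P) 𝓜.asset 𝓜.bank s).2.mono hle le_rfl).inv.smul
      ((hY.adapted s).measurable.mono hle le_rfl)
  have hmeas : Measurable[𝔽 ⊤] (payoff (discounted 𝓜.bank Y) τ) :=
    measurable_eval_of_ae_continuous (fun N hN => h𝔽'.measurableSet_of_null ⊤ hN) hm
      (𝓜.discounted_continuous hY.continuous) hτ.measurable_top
  obtain ⟨b, hb, h⟩ := 𝓜.exists_le_bank
  obtain ⟨K, hK⟩ := hY.bounded
  refine ⟨hmeas.stronglyMeasurable.aestronglyMeasurable,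
    -- `K` bounds the undiscounted claim and `b > 0` bounds the bank account from below at all
    -- times.
    memLp_top_of_bound (hmeas.mono (𝔽.le ⊤) le_rfl).aestronglyMeasurable (b⁻¹ * K) ?_⟩
  filter_upwards [h, hK] with ω h1 h2
  have hB := hb.trans_le (h1 (τ ω))
  rw [payoff, discounted, smul_eq_mul, norm_mul, norm_inv, Real.norm_eq_abs, Real.norm_eq_abs,
    abs_of_pos hB]
  exact mul_le_mul (inv_anti₀ hb (h1 _)) (h2 _) (abs_nonneg _) (inv_nonneg.2 hb.le)

end Market

end MarketProperties

/-! ### Risk estimates and essential bounds -/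

section RiskMeasures

variable {Ω : Type*} {m m' : MeasurableSpace Ω} [mΩ : MeasurableSpace Ω] {P : Measure Ω}
  {X Y : Ω → ℝ}

theorem MemLInf.mono (h : m ≤ m') (hX : MemLInf m P X) : MemLInf m' P X :=
  ⟨hX.1.mono h, hX.2⟩

theorem MemLInf.add (hX : MemLInf m P X) (hY : MemLInf m P Y) : MemLInf m P (X + Y) :=
  ⟨AEStronglyMeasurable.add hX.1 hY.1, hX.2.add hY.2⟩

theorem MemLInf.neg (hX : MemLInf m P X) : MemLInf m P (-X) :=
  ⟨AEStronglyMeasurable.neg hX.1, hX.2.neg⟩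

theorem MemLInf.sub (hX : MemLInf m P X) (hY : MemLInf m P Y) : MemLInf m P (X - Y) := by
  rw [sub_eq_add_neg]
  exact hX.add hY.neg

variable {T : ℝ≥0} {𝔽 : Filtration (Time T) mΩ}

/-- If `X` dominates `C + x` with `x` known at time `s`, then `ρ_{s,t}(X) ≤ ρ_{s,t}(C) - x`. -/
theorem RiskMeasure.le_sub_of_add_le (ρ : RiskMeasure 𝔽 P) {s t : Time T} (hst : s ≤ t)
    {C x : Ω → ℝ} (hX : MemLInf (𝔽 t) P X) (hC : MemLInf (𝔽 t) P C) (hx : MemLInf (𝔽 s) P x)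
    (h : C + x ≤ᵐ[P] X) : ρ.toFun s t X ≤ᵐ[P] ρ.toFun s t C - x := by
  have h1 := ρ.mono s t hst X (C + x) hX (hC.add (hx.mono (𝔽.mono hst))) h
  exact h1.trans (ρ.cash s t hst C x hC hx).le

variable [IsProbabilityMeasure P] {ι : Type*}

theorem essSupFam_le {Z : ι → Ω → EReal} {c : Ω → ℝ} (hc : AEMeasurable c P)
    (h : ∀ i, Z i ≤ᵐ[P] fun ω => (c ω : EReal)) :
    essSupFam P Z ≤ᵐ[P] fun ω => (c ω : EReal) := by
  -- Competitors for the essential infimum must be genuinely measurable, so `c` is replaced by a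
  -- measurable version.
  have h1 := (essInfFam_spec P fun i ω => -Z i ω).greatest (fun ω => ((-hc.mk c ω : ℝ) : EReal))
    hc.measurable_mk.neg.coe_real_ereal fun i => by
      filter_upwards [h i, hc.ae_eq_mk] with ω hω hω'
      rw [← hω', EReal.coe_neg]
      exact EReal.neg_le_neg_iff.2 hω
  filter_upwards [h1, hc.ae_eq_mk] with ω hω hω'
  rw [← hω', EReal.coe_neg] at hω
  exact EReal.neg_le.1 hω

/-- If `g ≤ Z_i + x` for all `i`, then `g - x ≤ ess inf Z`. -/
theorem sub_le_essInfFam {Z : ι → Ω → EReal} {g : Ω → EReal} (hg : Measurable g) {x : Ω → ℝ}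
    (hx : AEMeasurable x P) (h : ∀ i, ∀ᵐ ω ∂P, g ω - (x ω : EReal) ≤ Z i ω) :
    ∀ᵐ ω ∂P, g ω - (x ω : EReal) ≤ essInfFam P Z ω := by
  have h1 := (essInfFam_spec P Z).greatest (fun ω => g ω + ((-hx.mk x ω : ℝ) : EReal))
    (hg.add hx.measurable_mk.neg.coe_real_ereal) fun i => by
      filter_upwards [h i, hx.ae_eq_mk] with ω hω hω'
      rwa [← hω', EReal.coe_neg, ← sub_eq_add_neg]
  filter_upwards [h1, hx.ae_eq_mk] with ω hω hω'
  rwa [← hω', EReal.coe_neg, ← sub_eq_add_neg] at hω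

theorem measurable_residualRisk {d : ℕ} {𝕂 : Filtration (Time T) mΩ} (X : Time T → Ω → Euc d)
    (ρ : RiskMeasure 𝕂 P) (s t : Time T) (ζ : Ω → ℝ) :
    Measurable (residualRisk 𝔽 P X ρ s t ζ) :=
  (essInfFam_spec P _).measurable

/-- Not trading at all is admissible, so the residual risk is at most the real-valued `ρ(ζ)`. -/
theorem residualRisk_ne_top {d : ℕ} {𝕂 : Filtration (Time T) mΩ} (X : Time T → Ω → Euc d)
    (ρ : RiskMeasure 𝕂 P) (s t : Time T) (ζ : Ω → ℝ) :
    ∀ᵐ ω ∂P, residualRisk 𝔽 P X ρ s t ζ ω ≠ ⊤ := by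
  have hmem : (0 : Ω → ℝ) ∈ hedgeable 𝔽 P X s t :=
    ⟨fun _ _ => 0, 0, stronglyMeasurable_const, IsWealth.zero X s t, rfl⟩
  filter_upwards [(essInfFam_spec P fun (C : hedgeable 𝔽 P X s t) ω =>
    ((ρ.toFun s t (ζ + C) ω : ℝ) : EReal)).le ⟨0, hmem⟩] with ω hω
  exact (hω.trans_lt (EReal.coe_lt_top _)).ne

end RiskMeasures

/-! ### Exclusion of seller's and buyer's arbitrage -/

section Arbitrage

variable {Ω : Type*} [mΩ : MeasurableSpace Ω] {T : ℝ≥0} {P : Measure Ω} {d : ℕ}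
  {𝔽 : Filtration (Time T) mΩ} {I : Set (Time T)} {X : Time T → Ω → Euc d} {t : Time T}

/-- Adding an exercise-independent strategy to a seller's hedge. -/
def SellerHedge.add (G : SellerHedge 𝔽 P I X t) {h : Time T → Ω → Euc d} {V : Time T → Ω → ℝ}
    (hh : IsStronglyPredictable 𝔽 h) (hV : IsWealth 𝔽 P X t ⊤ h V) : SellerHedge 𝔽 P I X t where
  H := fun u => G.H u + h
  wealth := fun τ => G.wealth τ + V
  exerciseDependent :=
    { predictable := fun u hu =>
        StronglyMeasurable.add (G.exerciseDependent.predictable u hu) hh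
      nonanticipative := fun u hu v hv s ω hs =>
        congrArg (· + h s ω) (G.exerciseDependent.nonanticipative u hu v hv s ω hs)
      rightCont := fun hI u s ω =>
        (G.exerciseDependent.rightCont hI u s ω).add tendsto_const_nhds }
  isWealth := fun τ hτ => (G.isWealth τ hτ).add hV

variable [IsProbabilityMeasure P]

theorem Market.not_sellerArbitrage (𝓜 : Market Ω P T d) {Y : Time T → Ω → ℝ} (hY : 𝓜.IsClaim Y)
    (ρ : RiskMeasure 𝔽 P) (h𝔽 : 𝓜.sell ≤ 𝔽)
    (hbot : ∀ᵐ ω ∂P, residualRisk 𝓜.sell P 𝓜.S ρ t ⊤ 0 ω ≠ ⊥) :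
    ¬ SellerArbitrage 𝓜.sell P I 𝓜.S (discounted 𝓜.bank Y) t 𝔽
      (sellerPrice 𝓜.sell P I 𝓜.S (discounted 𝓜.bank Y) ρ t) := by
  rintro ⟨G, x, hx, hpos, harb⟩
  have hxm : AEMeasurable x P := hx.2.1.aemeasurable
  set p := essInfFam P (fun G : SellerHedge 𝓜.sell P I 𝓜.S t =>
      essSupFam P fun (τ : exerciseTimes 𝓜.sell I t) ω =>
        ((ρ.toFun t ⊤ (G.wealth τ ⊤ - payoff (discounted 𝓜.bank Y) τ) ω : ℝ) : EReal)) with hp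
  have hspec := essInfFam_spec P (fun G : SellerHedge 𝓜.sell P I 𝓜.S t =>
      essSupFam P fun (τ : exerciseTimes 𝓜.sell I t) ω =>
        ((ρ.toFun t ⊤ (G.wealth τ ⊤ - payoff (discounted 𝓜.bank Y) τ) ω : ℝ) : EReal))
  have key : ∀ᵐ ω ∂P, p ω - (x ω : EReal) ≤ residualRisk 𝓜.sell P 𝓜.S ρ t ⊤ 0 ω := by
    refine sub_le_essInfFam hspec.measurable hxm ?_
    rintro ⟨_, h, V, hh, hV, rfl⟩
    have hVm : MemLInf (𝔽 ⊤) P (V ⊤) :=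
      (𝓜.memLInf_wealth 𝓜.info_le_sell 𝓜.usual_sell hV).mono (h𝔽 ⊤)
    have hρm := (ρ.mapsTo t ⊤ le_top _ hVm).2.1.aemeasurable
    -- The bound does not depend on `τ`, so it passes to the essential supremum.
    have hsup := essSupFam_le (c := fun ω => ρ.toFun t ⊤ (V ⊤) ω + x ω) (hρm.add hxm)
      (Z := fun (τ : exerciseTimes 𝓜.sell I t) ω => ((ρ.toFun t ⊤
        ((G.add hh hV).wealth τ ⊤ - payoff (discounted 𝓜.bank Y) τ) ω : ℝ) : EReal))
      fun τ => by
        have hWm : MemLInf (𝔽 ⊤) P ((G.add hh hV).wealth τ ⊤) :=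
          (𝓜.memLInf_wealth 𝓜.info_le_sell 𝓜.usual_sell
            ((G.add hh hV).isWealth τ τ.2)).mono (h𝔽 ⊤)
        have hξm : MemLInf (𝔽 ⊤) P (payoff (discounted 𝓜.bank Y) τ) :=
          (hY.memLInf_payoff 𝓜.info_le_sell 𝓜.usual_sell τ.2.1).mono (h𝔽 ⊤)
        -- The cash amount is `-x`: covering the claim says that wealth minus payoff is at least
        -- `-x`.
        have hle := ρ.le_sub_of_add_le le_top (hWm.sub hξm) hVm hx.neg (by
          filter_upwards [harb τ τ.2] with ω hω
          simp only [SellerHedge.add, Pi.add_apply, Pi.neg_apply, Pi.sub_apply]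
          linarith)
        filter_upwards [hle] with ω hω
        refine EReal.coe_le_coe_iff.2 ?_
        simpa using hω
    filter_upwards [hspec.le (G.add hh hV), hsup] with ω h1 h2
    -- The residual risk of `0` is an infimum of `ρ(0 + C)`.
    rw [zero_add]
    refine EReal.sub_le_of_le_add ?_
    rw [← EReal.coe_add]
    exact h1.trans h2
  refine hpos.ne' (measure_eq_zero_iff_ae_notMem.2 ?_)
  filter_upwards [key, hbot, residualRisk_ne_top (𝔽 := 𝓜.sell) 𝓜.S ρ t ⊤ 0] with ω h1 h2 h3
  refine not_lt.2 (EReal.sub_le_of_le_add ?_)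
  rw [add_comm]
  exact (EReal.sub_le_iff_le_add (.inl (EReal.coe_ne_bot _)) (.inl (EReal.coe_ne_top _))).1 h1

theorem Market.not_buyerArbitrage (𝓜 : Market Ω P T d) {Y : Time T → Ω → ℝ} (hY : 𝓜.IsClaim Y)
    (ρ : RiskMeasure 𝔽 P) (h𝔽 : 𝓜.buy ≤ 𝔽)
    (hbot : ∀ᵐ ω ∂P, residualRisk 𝓜.buy P 𝓜.S ρ t ⊤ 0 ω ≠ ⊥) :
    ¬ BuyerArbitrage 𝓜.buy P I 𝓜.S (discounted 𝓜.bank Y) t 𝔽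
      (buyerPrice 𝓜.buy P I 𝓜.S (discounted 𝓜.bank Y) ρ t) := by
  rintro ⟨k, W, hk, hW, τ, hτ, x, hx, hpos, harb⟩
  have hxm : AEMeasurable x P := hx.2.1.aemeasurable
  have hξm : MemLInf (𝔽 ⊤) P (payoff (discounted 𝓜.bank Y) τ) :=
    (hY.memLInf_payoff 𝓜.info_le_buy 𝓜.usual_buy hτ.1).mono (h𝔽 ⊤)
  -- Subtracting `-x` instead of adding `x` matches the form of `sub_le_essInfFam`.
  have key : ∀ᵐ ω ∂P,
      residualRisk 𝓜.buy P 𝓜.S ρ t ⊤ (payoff (discounted 𝓜.bank Y) τ) ω -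
        (((-x) ω : ℝ) : EReal) ≤ residualRisk 𝓜.buy P 𝓜.S ρ t ⊤ 0 ω := by
    refine sub_le_essInfFam (measurable_residualRisk _ _ _ _ _) hxm.neg ?_
    rintro ⟨_, h, V, hh, hV, rfl⟩
    have hVm : MemLInf (𝔽 ⊤) P (V ⊤) :=
      (𝓜.memLInf_wealth 𝓜.info_le_buy 𝓜.usual_buy hV).mono (h𝔽 ⊤)
    have hVW := hV.add hW
    have hVWm : MemLInf (𝔽 ⊤) P ((V + W) ⊤) :=
      (𝓜.memLInf_wealth 𝓜.info_le_buy 𝓜.usual_buy hVW).mono (h𝔽 ⊤)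
    -- The competitor in the residual risk of the payoff: an arbitrary hedge plus the arbitrage
    -- hedge.
    have hmem : (V + W) ⊤ ∈ hedgeable 𝓜.buy P 𝓜.S t ⊤ :=
      ⟨h + k, V + W, StronglyMeasurable.add hh hk, hVW, rfl⟩
    have hle := ρ.le_sub_of_add_le le_top (hξm.add hVWm) hVm hx (by
      filter_upwards [harb] with ω hω
      simp only [Pi.add_apply]
      linarith)
    filter_upwards [hle, (essInfFam_spec P fun (C : hedgeable 𝓜.buy P 𝓜.S t ⊤) ω =>
      ((ρ.toFun t ⊤ (payoff (discounted 𝓜.bank Y) τ + C) ω : ℝ) : EReal)).le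
        ⟨_, hmem⟩] with ω h1 h2
    rw [zero_add]
    refine EReal.sub_le_of_le_add ?_
    rw [← EReal.coe_add]
    exact h2.trans (EReal.coe_le_coe_iff.2 h1)
  refine hpos.ne' (measure_eq_zero_iff_ae_notMem.2 ?_)
  filter_upwards [key, hbot, residualRisk_ne_top (𝔽 := 𝓜.buy) 𝓜.S ρ t ⊤ 0,
    (essInfFam_spec P fun τ : exerciseTimes 𝓜.buy I t =>
      residualRisk 𝓜.buy P 𝓜.S ρ t ⊤ (payoff (discounted 𝓜.bank Y) τ)).le ⟨τ, hτ⟩]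
    with ω h1 h2 h3 h4
  -- Moving a possibly infinite term across the inequality in `EReal` is legitimate because the
  -- residual risk of `0` is finite.
  refine not_lt.2 ((EReal.le_sub_iff_add_le (.inr h2) (.inr h3)).2 ?_)
  refine le_trans ?_ h1
  rw [Pi.neg_apply, EReal.coe_neg, sub_eq_add_neg, neg_neg, add_comm]
  exact add_le_add_left h4 _

end Arbitrage

theorem proposition2p4 {Ω : Type*} [mΩ : MeasurableSpace Ω] (P : Measure Ω) [IsProbabilityMeasure P]
    (T : ℝ≥0) (d : ℕ) (𝓜 : Market Ω P T d) (I : Set (Time T)) (hI : IsExerciseSet I)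
    (Y : Time T → Ω → ℝ) (hY : 𝓜.IsClaim Y) (t : Time T) :
    (∀ (𝔽 : Filtration (Time T) mΩ) (ρ : RiskMeasure 𝔽 P), 𝓜.sell ≤ 𝔽 → 𝔽 ≤ 𝓜.𝔾 →
      (∀ᵐ ω ∂P, residualRisk 𝓜.sell P 𝓜.S ρ t ⊤ 0 ω ≠ ⊥) →
      ¬ SellerArbitrage 𝓜.sell P I 𝓜.S (discounted 𝓜.bank Y) t 𝔽
        (sellerPrice 𝓜.sell P I 𝓜.S (discounted 𝓜.bank Y) ρ t)) ∧
    (∀ (𝔽 : Filtration (Time T) mΩ) (ρ : RiskMeasure 𝔽 P), 𝓜.buy ≤ 𝔽 → 𝔽 ≤ 𝓜.𝔾 →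
      (∀ᵐ ω ∂P, residualRisk 𝓜.buy P 𝓜.S ρ t ⊤ 0 ω ≠ ⊥) →
      ¬ BuyerArbitrage 𝓜.buy P I 𝓜.S (discounted 𝓜.bank Y) t 𝔽
        (buyerPrice 𝓜.buy P I 𝓜.S (discounted 𝓜.bank Y) ρ t)) := by
  exact ⟨fun 𝔽 ρ h _ hbot => 𝓜.not_sellerArbitrage hY ρ h hbot,
    fun 𝔽 ρ h _ hbot => 𝓜.not_buyerArbitrage hY ρ h hbot⟩
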